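/- **Theorem.** Let $k\ge 1$ and $T\ge 1$ be integers. Let $\Delta(k)\subset\mathbb R^k$ be the probability simplex, let $\mathcal X=\{e_1,\dots,e_k\}$ be the set of standard unit vectors of $\mathbb R^k$, and let $\mathcal Q$ be the set of Borel probability distributions on $\Delta(k)$. In the calibration game with $k$ outcomes, in each round $t=1,\dots,T$ the forecaster chooses $q_t\in\mathcal Q$, the adversary chooses $x_t\in\mathcal X$, and a forecast $f_t\in\Delta(k)$ is drawn from $q_t$; each choice may depend on everything that happened before it. At the end the forecaster suffers $$\mathbf R_T=\sup_{\lambda>0}\ \sup_{p\in\Delta(k)}\left\|\frac1T\sum_{t=1}^T \mathbf 1\{\|f_t-p\|_1\le\lambda\}\,(f_t-x_t)\right\|_1 ,$$ so that the scale $\lambda$ and the point $p$ are chosen after the game. The value of the game is $$\mathcal V_T=\inf_{q_1\in\mathcal Q}\ \sup_{x_1\in\mathcal X}\ \mathbb E_{f_1\sim q_1}\cdots\inf_{q_T\in\mathcal Q}\ \sup_{x_T\in\mathcal X}\ \mathbb E_{f_T\sim q_T}\ \mathbf R_T .$$ There is an absolute constant $c>0$, independent of $k$ and $T$, such that for all $k\ge1$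 and all $T\ge 3$ $$\mathcal V_T\le c\,k^2\left(\frac{\log T}{T}\right)^{1/2}.$$ -/

import Mathlib

open MeasureTheory

noncomputable section

namespace OnlineLearning

/-- The data of a `T`-round online game with learner moves `F`, adversary moves `X` and payoffs
in `H`: the payoff function `ℓ`, the (not necessarily additive) cumulative payoff `B`, and the set
`Φ_T` of sequences of payoff transformations `(F × X → H) → (F × X → H)`. -/
structure Game (F X H : Type*) (T : ℕ) where
  payoff : F → X → H
  cumulative : (Fin T → H) → ℝ
  transformations : Set (Fin T → (F → X → H) → (F → X → H))

variable {F X H : Type*} {T : ℕ}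

/-- The performance measure
`sup_{φ ∈ Φ_T} {B(ℓ(f₁,x₁), …, ℓ(f_T,x_T)) - B(ℓ_{φ₁}(f₁,x₁), …, ℓ_{φ_T}(f_T,x_T))}`.
The supremum is taken in the extended reals. -/
def Game.regret (G : Game F X H T) (f : Fin T → F) (x : Fin T → X) : EReal :=
  ⨆ φ ∈ G.transformations,
    ((G.cumulative (fun t => G.payoff (f t) (x t)) -
      G.cumulative (fun t => φ t G.payoff (f t) (x t)) : ℝ) : EReal)

/-- The expectation `E_{f ∼ q} g(f)` of an extended-real function, as an upper integral. It is the
ordinary integral whenever `g` is real and integrable (`expectation_coe`), and it is never below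
the integral, so no measurability question about `g` can make it artificially small. -/
def expectation [MeasurableSpace F] (q : ProbabilityMeasure F) (g : F → EReal) : EReal :=
  ⨅ (h : F → ℝ) (_ : Integrable h (q : Measure F))
    (_ : ∀ᵐ f ∂(q : Measure F), g f ≤ (h f : EReal)),
    ((∫ f, h f ∂(q : Measure F) : ℝ) : EReal)

theorem expectation_coe [MeasurableSpace F] (q : ProbabilityMeasure F) (g : F → ℝ)
    (hg : Integrable g (q : Measure F)) :
    expectation q (fun f => (g f : EReal)) = ((∫ f, g f ∂(q : Measure F) : ℝ) : EReal) := by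
  apply le_antisymm
  · exact iInf_le_of_le g (iInf_le_of_le hg
      (iInf_le_of_le (Filter.Eventually.of_forall fun _ => le_rfl) le_rfl))
  · refine le_iInf fun h => le_iInf fun hh => le_iInf fun hle => ?_
    rw [EReal.coe_le_coe_iff]
    refine integral_mono_ae hg hh ?_
    filter_upwards [hle] with f hf
    exact EReal.coe_le_coe_iff.mp hf

/-- The nested minimax expression
`inf_{q₁} sup_{x₁} E_{f₁ ∼ q₁} ⋯ inf_{q_n} sup_{x_n} E_{f_n ∼ q_n} R(f₁, x₁, …, f_n, x_n)`,
where each `q_t` ranges over the probability measures on `F` and each `x_t` over `X`. -/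
def nestedValue [MeasurableSpace F] :
    (n : ℕ) → ((Fin n → F) → (Fin n → X) → EReal) → EReal
  | 0, R => R Fin.elim0 Fin.elim0
  | n + 1, R =>
      ⨅ q : ProbabilityMeasure F, ⨆ x : X, expectation q fun f =>
        nestedValue n fun fs xs => R (Fin.cons f fs) (Fin.cons x xs)

/-- The value `V_T(ℓ, Φ_T)` of the game. -/
def Game.value [MeasurableSpace F] (G : Game F X H T) : EReal :=
  nestedValue T G.regret

/-- Forecasts of the calibration game: the probability simplex `Δ(k)`, with its Borel structure
inherited from `ℝ^k`. -/
abbrev Forecast (k : ℕ) : Type := stdSimplex ℝ (Fin k)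

/-- Outcomes of the calibration game: the standard unit vectors of `ℝ^k`. -/
abbrev Outcome (k : ℕ) : Type := Set.range fun i : Fin k => (Pi.single i 1 : Fin k → ℝ)

/-- `ℝ^k` with the `ℓ₁` norm. -/
abbrev L1Space (k : ℕ) : Type := PiLp 1 fun _ : Fin k => ℝ

open Classical in
/-- The transformed payoff `ℓ_{φ_{p,r}}(f, x) = 1{‖f - p‖₁ ≤ r} (f - x)`. -/
def calibrationPayoff {k : ℕ} (p : Forecast k) (r : ℝ) (f : Forecast k) (x : Outcome k) :
    L1Space k :=
  if ‖(WithLp.toLp 1 ((f : Fin k → ℝ) - (p : Fin k → ℝ)) : L1Space k)‖ ≤ r then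
    WithLp.toLp 1 ((f : Fin k → ℝ) - (x : Fin k → ℝ))
  else 0

/-- The `T`-round calibration game with `k` outcomes and the `ℓ₁` norm: `ℓ = 0`,
`B(z₁, …, z_T) = -‖(1/T) ∑ z_t‖₁`, and `Φ_T` consists of the constant sequences
`(φ_{p,r}, …, φ_{p,r})` with `p ∈ Δ(k)` and scale `r > 0`. -/
def calibrationGame (k T : ℕ) : Game (Forecast k) (Outcome k) (L1Space k) T where
  payoff := fun _ _ => 0
  cumulative := fun z => -‖(1 / (T : ℝ)) • ∑ t, z t‖
  transformations := {φ | ∃ (p : Forecast k) (r : ℝ), 0 < r ∧ φ = fun _ _ => calibrationPayoff p r}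

end OnlineLearning

end

/-!
The learner only ever forecasts points of a finite grid `G ⊆ Δ(k)` which is a `k / T`-net for the
`ℓ₁` distance and has at most `(T + 1) ^ k` points (`exists_forecast_net`). On such forecasts a ball
acts through its trace on `G`, and the `ℓ₁` norm is a maximum over sign vectors `σ`, so the regret
is `1 / T` times a maximum of cumulative gains `∑ₜ 1{fₜ ∈ S} ⟨σ, fₜ - xₜ⟩` over finitely many
experts `(σ, S)`, with `S` the trace of a ball (`regret_le_of_forall_gain_le`).

The maximum is controlled by the exponential potential `∑ exp (η · gain)`. Given any weights on the
experts, some mixed forecast makes the potential grow by a factor of at most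
`M = 1 + η δ + 4 η ²` in expectation, whatever the outcome (`exists_mixed_forecast_step`): by von
Neumann's minimax theorem it suffices to answer a known distribution `p` of the outcome, and
a grid point within `δ` of `p` gives every expert an expected gain of at most `δ`. Since the
expected growth is bounded outcome by outcome, the nested value of the final potential is at
most `M ^ T` times its initial value (`nestedValue_le_of_multiplicative_potential`). The logarithm
of the potential is replaced by its tangent at that bound, so that the payoff is affine in the
potential. This gives `log N / (η T) + δ + 4 η` for `N` experts (`value_le_of_net`).

It remains to see that `log N = O(k² log T)` (`log_card_experts_le`). Once the sets
`{a ∈ G : aᵢ ≤ pᵢ}` are known, `‖a - p‖₁ ≤ r` is a linear inequality in `k + 2` parameters, so the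
Sauer–Shelah lemma bounds the number of traces by `(|G| + 1) ^ (k + 2)`; and for each `i` those sets
form a chain, so they are determined by their cardinalities, which leaves `(|G| + 1) ^ k` cases
(`card_ballTraces_le`). The choice `η = k² √(log T / T)` concludes, unless it exceeds `1 / 2`, when
the trivial bound `2` on the value is enough.
-/

namespace OnlineLearning

/-! ### Minimax and the nested value -/

/-- **Von Neumann's minimax theorem**, in the form of a guarantee: if every mixed strategy of the
opponent has a pure answer with loss at most `c`, then some mixed strategy has loss at most `c`
against every pure strategy of the opponent. -/
theorem exists_mixed_le_of_forall_exists_pure_le {α β : Type*} [Fintype α] [Fintype β]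
    [Nonempty α] [Nonempty β] (L : α → β → ℝ) (c : ℝ)
    (h : ∀ p ∈ stdSimplex ℝ β, ∃ a, ∑ b, p b * L a b ≤ c) :
    ∃ q ∈ stdSimplex ℝ α, ∀ b, ∑ a, q a * L a b ≤ c := by
  classical
  obtain ⟨q, hq, p, hp, hs⟩ := Sion.exists_isSaddlePointOn
    (X := stdSimplex ℝ α) (Y := stdSimplex ℝ β)
    (f := fun q p => ∑ a, ∑ b, q a * p b * L a b)
    ⟨_, single_mem_stdSimplex ℝ (Classical.arbitrary α)⟩ (convex_stdSimplex ℝ α)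
    (isCompact_stdSimplex ℝ α)
    (fun p _ => Continuous.lowerSemicontinuous (by fun_prop) |>.lowerSemicontinuousOn _)
    (fun p _ => ConvexOn.quasiconvexOn ⟨convex_stdSimplex ℝ α, fun x _ y _ s t _ _ _ => by
      simp only [Pi.add_apply, Pi.smul_apply, smul_eq_mul, Finset.mul_sum, add_mul,
        Finset.sum_add_distrib, mul_assoc]; exact le_rfl⟩)
    (convex_stdSimplex ℝ β)
    ⟨_, single_mem_stdSimplex ℝ (Classical.arbitrary β)⟩
    (isCompact_stdSimplex ℝ β)
    (fun q _ => Continuous.upperSemicontinuous (by fun_prop) |>.upperSemicontinuousOn _)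
    (fun q _ => ConcaveOn.quasiconcaveOn ⟨convex_stdSimplex ℝ β, fun x _ y _ s t _ _ _ => by
      simp only [Pi.add_apply, Pi.smul_apply, smul_eq_mul, Finset.mul_sum, add_mul, mul_add,
        Finset.sum_add_distrib, mul_assoc, mul_left_comm]; exact le_rfl⟩)
  obtain ⟨a, ha⟩ := h p hp
  refine ⟨q, hq, fun b => ?_⟩
  have := hs (Pi.single a 1) (single_mem_stdSimplex ℝ a) (Pi.single b 1) (single_mem_stdSimplex ℝ b)
  simp [Pi.single_apply] at this
  linarith

/-- The probability measure with mass `q a` at each point `a` of the finite set `G`. -/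
noncomputable def finiteMixture {F : Type*} [MeasurableSpace F] {G : Finset F} (q : G → ℝ)
    (hq : q ∈ stdSimplex ℝ G) : ProbabilityMeasure F :=
  ⟨∑ a, ENNReal.ofReal (q a) • Measure.dirac (a : F), ⟨by
    have hsum : ∑ a, ENNReal.ofReal (q a) = 1 := by
      rw [← ENNReal.ofReal_sum_of_nonneg fun a _ => hq.1 a, hq.2, ENNReal.ofReal_one]
    simpa using hsum⟩⟩

theorem expectation_finiteMixture_le {F : Type*} [MeasurableSpace F] [MeasurableSingletonClass F]
    {G : Finset F} {q : G → ℝ} (hq : q ∈ stdSimplex ℝ G) {g : F → EReal} {h : G → ℝ}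
    (hg : ∀ a : G, g a ≤ (h a : EReal)) :
    expectation (finiteMixture q hq) g ≤ ((∑ a, q a * h a : ℝ) : EReal) := by
  have hext (a : G) : Function.extend Subtype.val h 0 (a : F) = h a :=
    Subtype.val_injective.extend_apply h 0 a
  have hint (a : G) : Integrable (Function.extend Subtype.val h 0)
      (ENNReal.ofReal (q a) • Measure.dirac (a : F)) :=
    (integrable_dirac (by simp)).smul_measure (by simp)
  -- The values of the majorant off `G` are irrelevant, because `G` has full measure.
  refine iInf_le_of_le (Function.extend Subtype.val h 0) (iInf_le_of_le ?_ (iInf_le_of_le ?_ ?_))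
  · exact integrable_finsetSum_measure.2 fun a _ => hint a
  · have hG : ∀ᵐ f ∂(finiteMixture q hq : Measure F), f ∈ (G : Set F) := by
      rw [ae_iff]
      simp [finiteMixture, Measure.dirac_apply]
    filter_upwards [hG] with f hf
    exact (hg ⟨f, hf⟩).trans_eq (by rw [← hext ⟨f, hf⟩])
  · refine le_of_eq ?_
    rw [EReal.coe_eq_coe_iff]
    show ∫ f, _ ∂(∑ a, ENNReal.ofReal (q a) • Measure.dirac (a : F)) = _
    rw [integral_finsetSum_measure fun a _ => hint a]
    refine Finset.sum_congr rfl fun a _ => ?_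
    rw [integral_smul_measure, integral_dirac, hext, ENNReal.toReal_ofReal (hq.1 a), smul_eq_mul]

/-- If for all nonnegative weights `w` the learner has a mixture on `G` under which `∑ i, w i` grows
in expectation by a factor of at most `M` when each `w i` is multiplied by `E i`, whatever the
adversary does, then a payoff that is at most the final total weight plus `B` has nested value at
most `M ^ n` times the initial total weight plus `B`. Only forecasts in `G` matter for the bound
on the payoff. -/
theorem nestedValue_le_of_multiplicative_potential {F X : Type*} [MeasurableSpace F]
    [MeasurableSingletonClass F] {G : Finset F} {ι : Type*} [Fintype ι] {E : ι → G → X → ℝ}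
    (hE : ∀ i a x, 0 ≤ E i a x) {M : ℝ} (hM : 0 ≤ M)
    (step : ∀ w : ι → ℝ, (∀ i, 0 ≤ w i) → ∃ q ∈ stdSimplex ℝ G, ∀ x,
      ∑ a, q a * ∑ i, w i * E i a x ≤ M * ∑ i, w i) (B : ℝ) (n : ℕ) :
    ∀ (w : ι → ℝ), (∀ i, 0 ≤ w i) → ∀ R : (Fin n → F) → (Fin n → X) → EReal,
      (∀ (fs : Fin n → G) (xs : Fin n → X), R (fun t => fs t) xs ≤
        ((∑ i, w i * ∏ t, E i (fs t) (xs t) + B : ℝ) : EReal)) →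
      nestedValue n R ≤ ((M ^ n * ∑ i, w i + B : ℝ) : EReal) := by
  induction n with
  | zero =>
    intro w _ R hR
    have h := hR Fin.elim0 Fin.elim0
    rw [Subsingleton.elim (fun t => ((Fin.elim0 t : G) : F)) Fin.elim0] at h
    simpa [nestedValue] using h
  | succ n ih =>
    intro w hw R hR
    obtain ⟨q, hq, hstep⟩ := step w hw
    refine iInf_le_of_le (finiteMixture q hq) (iSup_le fun x => ?_)
    refine (expectation_finiteMixture_le hq
      (h := fun a => M ^ n * ∑ i, w i * E i a x + B) fun a => ?_).trans ?_
    · refine ih (fun i => w i * E i a x) (fun i => mul_nonneg (hw i) (hE i a x)) _ fun fs xs => ?_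
      have h := hR (Fin.cons a fs) (Fin.cons x xs)
      have hcons : (fun t => ((Fin.cons a fs : Fin (n + 1) → G) t : F)) =
          Fin.cons (a : F) fun t => (fs t : F) := by
        funext t
        refine Fin.cases ?_ (fun t => ?_) t <;> simp
      rw [hcons] at h
      simpa only [Fin.prod_univ_succ, Fin.cons_zero, Fin.cons_succ, mul_assoc] using h
    · rw [EReal.coe_le_coe_iff]
      have h1 : ∑ a, q a * (M ^ n * ∑ i, w i * E i a x + B) =
          M ^ n * (∑ a, q a * ∑ i, w i * E i a x) + B := by
        simp only [mul_add, Finset.sum_add_distrib, ← Finset.sum_mul, hq.2, one_mul]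
        rw [Finset.mul_sum]
        congr 1
        exact Finset.sum_congr rfl fun a _ => by ring
      rw [h1, pow_succ, mul_assoc]
      gcongr
      exact hstep x

/-! ### Counting the traces of `ℓ₁` balls -/

theorem sum_Iic_choose_le_pow (n D : ℕ) : ∑ j ∈ Finset.Iic D, n.choose j ≤ (n + 1) ^ D := by
  rw [add_pow, Nat.range_succ_eq_Iic]
  refine Finset.sum_le_sum fun j hj => ?_
  have : 0 < D.choose j := Nat.choose_pos (Finset.mem_Iic.1 hj)
  simpa using (Nat.choose_le_pow n j).trans (Nat.le_mul_of_pos_right _ this)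

/-- Sets cut out by linear functionals on a space of dimension `D` have VC dimension at most `D`:
among more than `D` points there is a linear relation with a positive coefficient, and no functional
is positive exactly where the coefficient is positive, as the relation would then have
a positive value. -/
theorem vcDim_le_finrank_of_halfspaces {γ V : Type*} [DecidableEq γ] [AddCommGroup V] [Module ℝ V]
    [Module.Finite ℝ V] (φ : γ → V) (𝒜 : Finset (Finset γ))
    (h : ∀ S ∈ 𝒜, ∃ ℓ : V →ₗ[ℝ] ℝ, ∀ a, a ∈ S ↔ ℓ (φ a) ≤ 0) :
    𝒜.vcDim ≤ Module.finrank ℝ V := by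
  refine Finset.sup_le fun A hA => ?_
  rw [Finset.mem_shatterer] at hA
  by_contra! hcard
  have hdep : ¬ LinearIndependent ℝ fun a : A => φ a := fun hli => by
    have := hli.fintype_card_le_finrank
    rw [Fintype.card_coe] at this
    omega
  obtain ⟨c, hc, a₀, ha₀⟩ : ∃ c : A → ℝ, ∑ a, c a • φ a = 0 ∧ ∃ a, 0 < c a := by
    obtain ⟨c, hc, a, ha⟩ := Fintype.not_linearIndependent_iff.1 hdep
    rcases lt_or_gt_of_ne ha with ha | ha
    · exact ⟨-c, by simp only [Pi.neg_apply, neg_smul, Finset.sum_neg_distrib, hc, neg_zero], a,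
        by simpa using ha⟩
    · exact ⟨c, hc, a, ha⟩
  obtain ⟨S, hS, hAS⟩ := hA (Finset.filter_subset
    (fun a => ∃ ha : a ∈ A, c ⟨a, ha⟩ ≤ 0) A)
  obtain ⟨ℓ, hℓ⟩ := h S hS
  have hmem (a : A) : ℓ (φ a) ≤ 0 ↔ c a ≤ 0 := by
    have := congrArg ((a : γ) ∈ ·) hAS
    simpa [hℓ] using this
  have hzero : ∑ a, c a * ℓ (φ a) = 0 := by
    have := congrArg ℓ hc
    simpa using this
  refine hzero.not_gt (Finset.sum_pos' (fun a _ => ?_) ⟨a₀, Finset.mem_univ _, ?_⟩)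
  · rcases le_or_gt (c a) 0 with ha | ha
    · exact mul_nonneg_of_nonpos_of_nonpos ha ((hmem a).2 ha)
    · exact (mul_pos ha (not_le.1 fun h => ha.not_ge ((hmem a).1 h))).le
  · exact mul_pos ha₀ (not_le.1 fun h => ha₀.not_ge ((hmem a₀).1 h))

theorem card_le_pow_of_halfspaces {γ V : Type*} [Fintype γ] [DecidableEq γ] [AddCommGroup V]
    [Module ℝ V] [Module.Finite ℝ V] (φ : γ → V) (𝒜 : Finset (Finset γ))
    (h : ∀ S ∈ 𝒜, ∃ ℓ : V →ₗ[ℝ] ℝ, ∀ a, a ∈ S ↔ ℓ (φ a) ≤ 0) :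
    𝒜.card ≤ (Fintype.card γ + 1) ^ Module.finrank ℝ V :=
  calc 𝒜.card ≤ ∑ j ∈ Finset.Iic 𝒜.vcDim, (Fintype.card γ).choose j :=
        𝒜.card_le_card_shatterer.trans Finset.card_shatterer_le_sum_vcDim
    _ ≤ (Fintype.card γ + 1) ^ 𝒜.vcDim := sum_Iic_choose_le_pow _ _
    _ ≤ _ := Nat.pow_le_pow_right (Nat.succ_pos _) (vcDim_le_finrank_of_halfspaces φ 𝒜 h)

open scoped Classical in
/-- The set of indices `a` for which the point `y a` lies in the closed `ℓ₁` ball of centre `p` and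
radius `r`. -/
noncomputable def ballTrace {γ ι : Type*} [Fintype γ] [Fintype ι] (y : γ → ι → ℝ)
    (p : ι → ℝ) (r : ℝ) : Finset γ :=
  Finset.univ.filter fun a => ∑ i, |y a i - p i| ≤ r

theorem mem_ballTrace {γ ι : Type*} [Fintype γ] [Fintype ι] {y : γ → ι → ℝ} {p : ι → ℝ} {r : ℝ}
    {a : γ} : a ∈ ballTrace y p r ↔ ∑ i, |y a i - p i| ≤ r := by
  simp [ballTrace]

open Classical in
theorem card_ballTraces_le {γ : Type*} {k : ℕ} [Fintype γ]
    (y : γ → Fin k → ℝ) (𝒜 : Finset (Finset γ)) (h𝒜 : ∀ S ∈ 𝒜, ∃ p r, S = ballTrace y p r) :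
    𝒜.card ≤ (Fintype.card γ + 1) ^ (2 * k + 2) := by
  choose! p r hpr using h𝒜
  -- For fixed `S`, the signs of `y a i - p S i` are recorded by the sets `U S i`.
  let U (S : Finset γ) (i : Fin k) : Finset γ := Finset.univ.filter fun a => y a i ≤ p S i
  let code (S : Finset γ) (i : Fin k) : Fin (Fintype.card γ + 1) :=
    ⟨(U S i).card, Nat.lt_succ_of_le (Finset.card_le_univ _)⟩
  have hU {S S' : Finset γ} (hc : code S = code S') (a : γ) (i : Fin k) :
      y a i ≤ p S i ↔ y a i ≤ p S' i := by
    have hcard : (U S i).card = (U S' i).card := congrArg Fin.val (congrFun hc i)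
    -- Sublevel sets of `y · i` form a chain, so equal cardinality forces equality.
    have heq : U S i = U S' i := by
      rcases le_total (p S i) (p S' i) with hle | hle
      · exact Finset.eq_of_subset_of_card_le
          (Finset.monotone_filter_right _ fun a _ ha => le_trans ha hle) hcard.ge
      · exact (Finset.eq_of_subset_of_card_le
          (Finset.monotone_filter_right _ fun a _ ha => le_trans ha hle) hcard.le).symm
    simpa [U] using congrArg (a ∈ ·) heq
  have hfib (c : Fin k → Fin (Fintype.card γ + 1)) :
      (𝒜.filter fun S => code S = c).card ≤ (Fintype.card γ + 1) ^ (k + 2) := by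
    rcases (𝒜.filter fun S => code S = c).eq_empty_or_nonempty with he | ⟨S₀, hS₀⟩
    · simp [he]
    have hc₀ : code S₀ = c := (Finset.mem_filter.1 hS₀).2
    let s (a : γ) (i : Fin k) : ℝ := if y a i ≤ p S₀ i then -1 else 1
    -- With the signs `s a i` fixed on the fibre, `‖y a - p‖₁ - r` is a linear functional, with
    -- parameters `(1, r, p)`, of the vector `(∑ i, s a i * y a i, 1, s a)`.
    have hrank : Module.finrank ℝ (ℝ × ℝ × (Fin k → ℝ)) = k + 2 := by
      simp; ring
    rw [← hrank]
    refine card_le_pow_of_halfspaces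
      (fun a => ((∑ i, s a i * y a i, 1, s a) : ℝ × ℝ × (Fin k → ℝ))) _ fun S hS => ?_
    obtain ⟨hS, hcS⟩ := Finset.mem_filter.1 hS
    refine ⟨LinearMap.fst ℝ _ _ - r S • (LinearMap.fst ℝ _ _ ∘ₗ LinearMap.snd ℝ _ _) -
      ∑ i, p S i • (LinearMap.proj i ∘ₗ LinearMap.snd ℝ _ _ ∘ₗ LinearMap.snd ℝ _ _),
      fun a => ?_⟩
    have habs (i : Fin k) : |y a i - p S i| = s a i * y a i - p S i * s a i := by
      have := hU (hcS.trans hc₀.symm) a i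
      by_cases hi : y a i ≤ p S₀ i
      · rw [abs_of_nonpos (by linarith [this.2 hi])]
        simp only [s, if_pos hi]; ring
      · rw [abs_of_pos (by linarith [not_le.1 fun h => hi (this.1 h)])]
        simp only [s, if_neg hi]; ring
    have key : a ∈ S ↔ ∑ i, |y a i - p S i| ≤ r S := by
      conv_lhs => rw [hpr S hS]
      exact mem_ballTrace
    rw [key]
    simp only [habs, Finset.sum_sub_distrib]
    simp [LinearMap.sum_apply]
    constructor <;> intro h <;> linarith
  calc 𝒜.card ≤ (Fintype.card γ + 1) ^ (k + 2) *
        (Finset.univ : Finset (Fin k → Fin (Fintype.card γ + 1))).card :=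
        Finset.card_le_mul_card_image_of_maps_to (f := code) (fun _ _ => Finset.mem_univ _) _
          fun c _ => hfib c
    _ = _ := by
      simp [← pow_add]; ring_nf

/-! ### Gains of the experts in the calibration game -/

open Classical in
/-- The traces on `G` of all closed `ℓ₁` balls; the centres range over all of `ℝ^k`. -/
noncomputable def ballTraces {k : ℕ} (G : Finset (Forecast k)) : Finset (Finset G) :=
  Finset.univ.filter fun S =>
    ∃ (p : Fin k → ℝ) (r : ℝ), S = ballTrace (fun (a : G) i => (a : Forecast k).1 i) p r

theorem mem_ballTraces {k : ℕ} {G : Finset (Forecast k)} {S : Finset G} : S ∈ ballTraces G ↔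
    ∃ (p : Fin k → ℝ) (r : ℝ), S = ballTrace (fun (a : G) i => (a : Forecast k).1 i) p r := by
  simp [ballTraces]

theorem ballTrace_mem_ballTraces {k : ℕ} (G : Finset (Forecast k)) (p : Fin k → ℝ) (r : ℝ) :
    ballTrace (fun (a : G) i => (a : Forecast k).1 i) p r ∈ ballTraces G :=
  mem_ballTraces.2 ⟨p, r, rfl⟩

open Classical in
/-- The gain `1{a ∈ S} ⟨σ, a - x⟩` of the expert `(σ, S)` when the forecast is `a` and the outcome
is `x`. -/
noncomputable def gain {k : ℕ} {G : Finset (Forecast k)} (σ : Fin k → SignType) (S : Finset G)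
    (a : G) (x : Outcome k) : ℝ :=
  if a ∈ S then ∑ i, (σ i : ℝ) * ((a : Forecast k).1 i - x.1 i) else 0

theorem abs_signType_le_one (s : SignType) : |(s : ℝ)| ≤ 1 := by
  cases s <;> simp

theorem sum_abs_eq_one_of_mem_stdSimplex {k : ℕ} {p : Fin k → ℝ} (hp : p ∈ stdSimplex ℝ (Fin k)) :
    ∑ i, |p i| = 1 := by
  rw [← hp.2]
  exact Finset.sum_congr rfl fun i _ => abs_of_nonneg (hp.1 i)

theorem abs_sum_sign_mul_le {k : ℕ} (σ : Fin k → SignType) (v : Fin k → ℝ) :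
    |∑ i, (σ i : ℝ) * v i| ≤ ∑ i, |v i| := by
  refine (Finset.abs_sum_le_sum_abs _ _).trans (Finset.sum_le_sum fun i _ => ?_)
  rw [abs_mul]
  exact mul_le_of_le_one_left (abs_nonneg _) (abs_signType_le_one _)

theorem abs_gain_le_two {k : ℕ} {G : Finset (Forecast k)} (σ : Fin k → SignType) (S : Finset G)
    (a : G) (x : Outcome k) : |gain σ S a x| ≤ 2 := by
  unfold gain
  split_ifs
  · have hx : x.1 ∈ stdSimplex ℝ (Fin k) := by
      obtain ⟨_, j, rfl⟩ := x
      exact single_mem_stdSimplex ℝ j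
    calc _ ≤ ∑ i, |(a : Forecast k).1 i - x.1 i| := abs_sum_sign_mul_le _ _
      _ ≤ ∑ i, (|(a : Forecast k).1 i| + |x.1 i|) := Finset.sum_le_sum fun i _ => abs_sub _ _
      _ = 2 := by
        rw [Finset.sum_add_distrib, sum_abs_eq_one_of_mem_stdSimplex (a : Forecast k).2,
          sum_abs_eq_one_of_mem_stdSimplex hx]
        norm_num
  · simp

/-- The `j`-th outcome. -/
def outcome {k : ℕ} (j : Fin k) : Outcome k := ⟨Pi.single j 1, j, rfl⟩

theorem sum_mul_gain_le {k : ℕ} {G : Finset (Forecast k)} (σ : Fin k → SignType) (S : Finset G)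
    (a : G) {p : Fin k → ℝ} (hp : p ∈ stdSimplex ℝ (Fin k)) :
    ∑ j, p j * gain σ S a (outcome j) ≤ ∑ i, |(a : Forecast k).1 i - p i| := by
  by_cases ha : a ∈ S
  · have h : ∑ j, p j * gain σ S a (outcome j) =
        ∑ i, (σ i : ℝ) * ((a : Forecast k).1 i - p i) := by
      simp only [gain, if_pos ha, outcome, mul_sub, Finset.sum_sub_distrib, ← Finset.sum_mul, hp.2,
        one_mul]
      congr 1
      exact Finset.sum_congr rfl fun j _ => by simp [Pi.single_apply, mul_comm]
    rw [h]
    exact (le_abs_self _).trans (abs_sum_sign_mul_le _ _)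
  · simp only [gain, if_neg ha, mul_zero, Finset.sum_const_zero]
    positivity

theorem sum_mul_exp_gain_le {k : ℕ} {G : Finset (Forecast k)} (σ : Fin k → SignType)
    (S : Finset G) (a : G) {p : Fin k → ℝ} (hp : p ∈ stdSimplex ℝ (Fin k)) {δ η : ℝ}
    (hη : 0 ≤ η) (hη' : η ≤ 1 / 2) (ha : ∑ i, |(a : Forecast k).1 i - p i| ≤ δ) :
    ∑ j, p j * Real.exp (η * gain σ S a (outcome j)) ≤ 1 + η * δ + 4 * η ^ 2 := by
  have hexp (j : Fin k) : Real.exp (η * gain σ S a (outcome j)) ≤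
      1 + η * gain σ S a (outcome j) + 4 * η ^ 2 := by
    have hg := abs_gain_le_two σ S a (outcome j)
    have h1 : |η * gain σ S a (outcome j)| ≤ 2 * η := by
      rw [abs_mul, abs_of_nonneg hη]; nlinarith
    have h2 := (abs_le.1 (Real.abs_exp_sub_one_sub_id_le (h1.trans (by linarith)))).2
    have h3 := sq_le_sq' (abs_le.1 h1).1 (abs_le.1 h1).2
    nlinarith
  calc _ ≤ ∑ j, p j * (1 + η * gain σ S a (outcome j) + 4 * η ^ 2) :=
        Finset.sum_le_sum fun j _ => mul_le_mul_of_nonneg_left (hexp j) (hp.1 j)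
    _ = 1 + η * ∑ j, p j * gain σ S a (outcome j) + 4 * η ^ 2 := by
        simp only [mul_add, Finset.sum_add_distrib, mul_one, hp.2, ← Finset.sum_mul, one_mul,
          Finset.mul_sum, mul_left_comm η]
    _ ≤ _ := by
        gcongr
        exact (sum_mul_gain_le σ S a hp).trans ha

/-- Whatever the weights of the experts, some mixture of grid points makes the exponentially
updated total weight grow in expectation by a factor of at most `1 + η δ + 4 η ²`, for every
outcome. -/
theorem exists_mixed_forecast_step {k : ℕ} (hk : 1 ≤ k) {G : Finset (Forecast k)} {δ η : ℝ}
    (hη : 0 ≤ η) (hη' : η ≤ 1 / 2)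
    (hG : ∀ p : Forecast k, ∃ a ∈ G, ∑ i, |a.1 i - p.1 i| ≤ δ)
    (w : (Fin k → SignType) × ballTraces G → ℝ) (hw : ∀ i, 0 ≤ w i) :
    ∃ q ∈ stdSimplex ℝ G, ∀ x : Outcome k,
      ∑ a, q a * ∑ i, w i * Real.exp (η * gain i.1 i.2.1 a x) ≤
        (1 + η * δ + 4 * η ^ 2) * ∑ i, w i := by
  have : Nonempty (Fin k) := ⟨⟨0, hk⟩⟩
  have : Nonempty G :=
    let ⟨a, ha, _⟩ := hG ⟨_, single_mem_stdSimplex ℝ ⟨0, hk⟩⟩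
    ⟨⟨a, ha⟩⟩
  obtain ⟨q, hq, h⟩ := exists_mixed_le_of_forall_exists_pure_le
    (fun (a : G) (j : Fin k) => ∑ i, w i * Real.exp (η * gain i.1 i.2.1 a (outcome j)))
    ((1 + η * δ + 4 * η ^ 2) * ∑ i, w i) fun p hp => by
      obtain ⟨a, ha, hap⟩ := hG ⟨p, hp⟩
      refine ⟨⟨a, ha⟩, ?_⟩
      simp only [Finset.mul_sum]
      rw [Finset.sum_comm]
      refine Finset.sum_le_sum fun i _ => ?_
      have := mul_le_mul_of_nonneg_left
        (sum_mul_exp_gain_le i.1 i.2.1 ⟨a, ha⟩ hp hη hη' hap) (hw i)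
      rw [Finset.mul_sum] at this
      simpa only [mul_left_comm (w i), mul_comm (w i)] using this
  refine ⟨q, hq, ?_⟩
  rintro ⟨_, j, rfl⟩
  exact h j

/-- The regret is a supremum of `ℓ₁` norms of averages, and each norm is attained as a pairing with
the sign vector of the average; hence it is a maximum of average gains of experts. -/
theorem regret_le_of_forall_gain_le {k T : ℕ} {G : Finset (Forecast k)} (fs : Fin T → G)
    (xs : Fin T → Outcome k) (C : ℝ)
    (h : ∀ σ : Fin k → SignType, ∀ S ∈ ballTraces G,
      1 / (T : ℝ) * ∑ t, gain σ S (fs t) (xs t) ≤ C) :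
    (calibrationGame k T).regret (fun t => fs t) xs ≤ (C : EReal) := by
  refine iSup₂_le fun φ hφ => ?_
  obtain ⟨p, r, -, rfl⟩ := hφ
  rw [EReal.coe_le_coe_iff]
  let S := ballTrace (fun (a : G) i => (a : Forecast k).1 i) p.1 r
  let z (t : Fin T) : L1Space k := calibrationPayoff p r (fs t) (xs t)
  let σ (i : Fin k) : SignType := SignType.sign (∑ t, z t i)
  have hz (t : Fin T) : ∑ i, (σ i : ℝ) * z t i = gain σ S (fs t) (xs t) := by
    have hmem : fs t ∈ S ↔
        ‖(WithLp.toLp 1 (((fs t : Forecast k) : Fin k → ℝ) - (p : Fin k → ℝ)) :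
          L1Space k)‖ ≤ r := by
      rw [PiLp.norm_eq_of_L1]
      exact mem_ballTrace
    by_cases ht : fs t ∈ S
    · simp only [z, calibrationPayoff, if_pos (hmem.1 ht), gain, if_pos ht]
      rfl
    · simp only [z, calibrationPayoff, if_neg (mt hmem.2 ht), gain, if_neg ht]
      simp
  have hnorm : ‖(1 / (T : ℝ)) • ∑ t, z t‖ = 1 / (T : ℝ) * ∑ t, gain σ S (fs t) (xs t) := by
    rw [norm_smul, PiLp.norm_eq_of_L1, Real.norm_of_nonneg (by positivity)]
    congr 1
    calc ∑ i, ‖(∑ t, z t) i‖ = ∑ i, ∑ t, (σ i : ℝ) * z t i :=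
          Finset.sum_congr rfl fun i _ => by
            rw [← Finset.mul_sum, Real.norm_eq_abs, ← sign_mul_self]
            simp [σ]
      _ = _ := by rw [Finset.sum_comm]; exact Finset.sum_congr rfl fun t _ => hz t
  have := h σ S (ballTrace_mem_ballTraces G p.1 r)
  have h0 : (calibrationGame k T).cumulative
      (fun t => (calibrationGame k T).payoff (fs t) (xs t)) = 0 := by
    simp [calibrationGame]
  have h1 : (calibrationGame k T).cumulative (fun t => calibrationPayoff p r (fs t) (xs t)) =
      -‖(1 / (T : ℝ)) • ∑ t, z t‖ := rfl
  rw [h0, h1, hnorm]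
  linarith

/-! ### Bounds on the value -/

/-- The trivial bound. It is obtained from the empty family of experts and a one-point grid. -/
theorem value_le_two {k T : ℕ} (hk : 1 ≤ k) : (calibrationGame k T).value ≤ ((2 : ℝ) : EReal) := by
  let G : Finset (Forecast k) := {⟨_, single_mem_stdSimplex ℝ ⟨0, hk⟩⟩}
  have hG : Nonempty G := ⟨⟨_, Finset.mem_singleton_self _⟩⟩
  have h := nestedValue_le_of_multiplicative_potential (G := G) (ι := Empty) (X := Outcome k)
    (E := fun _ _ _ => 1) (fun _ _ _ => zero_le_one) (zero_le_one (α := ℝ))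
    (fun w _ => ⟨_, single_mem_stdSimplex ℝ (Classical.arbitrary G), by simp⟩) 2 T
    (fun _ => 0) (fun _ => le_rfl) (calibrationGame k T).regret fun fs xs => by
      refine regret_le_of_forall_gain_le fs xs _ fun σ S _ => ?_
      have hsum : ∑ t, gain σ S (fs t) (xs t) ≤ ∑ _t : Fin T, (2 : ℝ) :=
        Finset.sum_le_sum fun t _ => (abs_le.1 (abs_gain_le_two σ S (fs t) (xs t))).2
      rw [Finset.sum_const, Finset.card_univ, Fintype.card_fin, nsmul_eq_mul] at hsum
      -- For `T = 0` the average is `1 / 0 * 0 = 0`.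
      rcases Nat.eq_zero_or_pos T with rfl | hT
      · simp
      · rw [Finset.univ_eq_empty (α := Empty), Finset.sum_empty, zero_add, one_div_mul_eq_div,
          div_le_iff₀ (by positivity)]
        linarith
  simpa [Game.value] using h

/-- The bound from exponential weights with learning rate `η` on a `δ`-net `G`; there are
`3 ^ k * (ballTraces G).card` experts, the sign vectors having entries in `{-1, 0, 1}`. -/
theorem value_le_of_net {k T : ℕ} (hk : 1 ≤ k) (hT : 1 ≤ T) {G : Finset (Forecast k)} {δ η : ℝ}
    (hδ : 0 ≤ δ) (hη : 0 < η) (hη' : η ≤ 1 / 2)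
    (hG : ∀ p : Forecast k, ∃ a ∈ G, ∑ i, |a.1 i - p.1 i| ≤ δ) :
    (calibrationGame k T).value ≤
      ((Real.log (3 ^ k * (ballTraces G).card) / (η * T) + δ + 4 * η : ℝ) : EReal) := by
  have hTpos : (0 : ℝ) < T := by exact_mod_cast hT
  set M : ℝ := 1 + η * δ + 4 * η ^ 2 with hM
  have hMpos : 0 < M := by positivity
  set N : ℝ := 3 ^ k * (ballTraces G).card with hN
  have hNpos : 0 < N := by
    have : 0 < (ballTraces G).card := Finset.card_pos.2 ⟨_, ballTrace_mem_ballTraces G 0 0⟩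
    positivity
  set A : ℝ := N * M ^ T with hA
  have hApos : 0 < A := by positivity
  -- The initial weights and the constant come from `log y ≤ y / A - 1 + log A`, where `A` bounds the
  -- expected final potential.
  refine (nestedValue_le_of_multiplicative_potential (G := G)
    (E := fun (i : (Fin k → SignType) × ballTraces G) a x => Real.exp (η * gain i.1 i.2.1 a x))
    (fun _ _ _ => (Real.exp_pos _).le) hMpos.le
    (exists_mixed_forecast_step hk hη.le hη' hG) ((Real.log A - 1) / (η * T)) T
    (fun _ => 1 / (η * T * A)) (fun _ => by positivity) (calibrationGame k T).regret
    fun fs xs => ?_).trans ?_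
  · refine regret_le_of_forall_gain_le fs xs _ fun σ S hS => ?_
    set Φ : ℝ := ∑ i : (Fin k → SignType) × ballTraces G,
      ∏ t, Real.exp (η * gain i.1 i.2.1 (fs t) (xs t)) with hΦ
    have hle : Real.exp (η * ∑ t, gain σ S (fs t) (xs t)) ≤ Φ := by
      rw [Finset.mul_sum, Real.exp_sum]
      exact Finset.single_le_sum
        (f := fun i : (Fin k → SignType) × ballTraces G =>
          ∏ t, Real.exp (η * gain i.1 i.2.1 (fs t) (xs t)))
        (fun i _ => Finset.prod_nonneg fun t _ => (Real.exp_pos _).le)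
        (Finset.mem_univ ((σ, ⟨S, hS⟩) : (Fin k → SignType) × ballTraces G))
    have hΦpos : 0 < Φ := (Real.exp_pos _).trans_le hle
    have hlog : η * ∑ t, gain σ S (fs t) (xs t) ≤ Φ / A - 1 + Real.log A := by
      have h1 := (Real.le_log_iff_exp_le hΦpos).2 hle
      have h2 := Real.log_le_sub_one_of_pos (div_pos hΦpos hApos)
      rw [Real.log_div hΦpos.ne' hApos.ne'] at h2
      linarith
    rw [← Finset.mul_sum, ← hΦ]
    calc 1 / (T : ℝ) * ∑ t, gain σ S (fs t) (xs t)
        = (η * ∑ t, gain σ S (fs t) (xs t)) / (η * T) := by field_simp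
      _ ≤ (Φ / A - 1 + Real.log A) / (η * T) := by gcongr
      _ = _ := by field_simp; ring
  · rw [EReal.coe_le_coe_iff]
    have hlogM : Real.log M ≤ η * δ + 4 * η ^ 2 := by
      have := Real.log_le_sub_one_of_pos hMpos
      linarith
    have hlogA : Real.log A ≤ Real.log N + T * (η * δ + 4 * η ^ 2) := by
      rw [hA, Real.log_mul hNpos.ne' (by positivity), Real.log_pow]
      gcongr
    have hsum : ∑ _i : (Fin k → SignType) × ballTraces G, 1 / (η * T * A) =
        N * (1 / (η * T * A)) := by
      rw [Finset.sum_const, Finset.card_univ, nsmul_eq_mul, Fintype.card_prod, Fintype.card_fun,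
        Fintype.card_coe, Fintype.card_fin, hN]
      have : Fintype.card SignType = 3 := rfl
      rw [this]
      push_cast
      rfl
    calc M ^ T * ∑ _i : (Fin k → SignType) × ballTraces G, 1 / (η * T * A) +
          (Real.log A - 1) / (η * T) = Real.log A / (η * T) := by
          rw [hsum, hA]; field_simp; ring
      _ ≤ (Real.log N + T * (η * δ + 4 * η ^ 2)) / (η * T) := by gcongr
      _ = _ := by field_simp; ring

/-! ### The grid and the number of experts -/

/-- The net has one point of the simplex in each nonempty cell of the cubical grid of mesh
`1 / m`, so no rounding back to the simplex is needed. -/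
theorem exists_forecast_net {k : ℕ} (hk : 1 ≤ k) {m : ℕ} (hm : 1 ≤ m) :
    ∃ G : Finset (Forecast k), G.card ≤ (m + 1) ^ k ∧
      ∀ p : Forecast k, ∃ a ∈ G, ∑ i, |a.1 i - p.1 i| ≤ (k : ℝ) / m := by
  classical
  have hmpos : (0 : ℝ) < m := by exact_mod_cast hm
  have : Nonempty (Forecast k) := ⟨⟨_, single_mem_stdSimplex ℝ ⟨0, hk⟩⟩⟩
  let code (p : Forecast k) (i : Fin k) : Fin (m + 1) := ⟨⌊m * p.1 i⌋₊, by
    have h1 : p.1 i ≤ 1 :=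
      p.2.2 ▸ Finset.single_le_sum (fun j _ => p.2.1 j) (Finset.mem_univ i)
    refine Nat.lt_succ_of_le (Nat.floor_le_of_le ?_)
    nlinarith⟩
  refine ⟨Finset.univ.image (Function.invFun code), ?_, fun p => ?_⟩
  · exact Finset.card_image_le.trans (by simp)
  · refine ⟨_, Finset.mem_image_of_mem _ (Finset.mem_univ (code p)), ?_⟩
    set a := Function.invFun code (code p)
    have ha : code a = code p := Function.invFun_eq ⟨p, rfl⟩
    have hclose (i : Fin k) : |a.1 i - p.1 i| ≤ 1 / m := by
      have hfl : ⌊m * a.1 i⌋₊ = ⌊m * p.1 i⌋₊ := congrArg Fin.val (congrFun ha i)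
      have ha1 := Nat.floor_le (mul_nonneg hmpos.le (a.2.1 i))
      have ha2 := Nat.lt_floor_add_one ((m : ℝ) * a.1 i)
      have hp1 := Nat.floor_le (mul_nonneg hmpos.le (p.2.1 i))
      have hp2 := Nat.lt_floor_add_one ((m : ℝ) * p.1 i)
      rw [hfl] at ha1 ha2
      rw [abs_le, le_div_iff₀ hmpos, neg_le, le_div_iff₀ hmpos]
      constructor <;> nlinarith
    calc _ ≤ ∑ _i : Fin k, 1 / (m : ℝ) := Finset.sum_le_sum fun i _ => hclose i
      _ = _ := by simp [div_eq_mul_inv]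

theorem log_card_experts_le {k T : ℕ} (hk : 1 ≤ k) (hT : 3 ≤ T) {G : Finset (Forecast k)}
    (hG : G.card ≤ (T + 1) ^ k) :
    Real.log (3 ^ k * (ballTraces G).card) ≤ 10 * k ^ 2 * Real.log T := by
  have hlog3 : Real.log 3 ≤ Real.log T := Real.log_le_log (by norm_num) (by exact_mod_cast hT)
  have hlogT : 0 ≤ Real.log T := Real.log_natCast_nonneg T
  have hk' : (1 : ℝ) ≤ k := by exact_mod_cast hk
  have hbase : G.card + 1 ≤ T ^ (2 * k) := by
    have h1 : (1 : ℕ) ≤ (T + 1) ^ k := Nat.one_le_pow _ _ (by omega)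
    have h2 : (T + 1) ^ k + 1 ≤ (T + 2) ^ k := by
      exact Nat.pow_lt_pow_left (by omega) (by omega)
    have h3 : (T + 2) ^ k ≤ T ^ (2 * k) := by
      rw [pow_mul]
      exact Nat.pow_le_pow_left (by nlinarith) k
    omega
  have hcard : (ballTraces G).card ≤ T ^ (2 * k * (2 * k + 2)) := by
    refine (card_ballTraces_le _ (ballTraces G) fun S hS => mem_ballTraces.1 hS).trans ?_
    rw [Fintype.card_coe, pow_mul]
    exact Nat.pow_le_pow_left hbase _
  have hpos : 0 < (ballTraces G).card := Finset.card_pos.2 ⟨_, ballTrace_mem_ballTraces G 0 0⟩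
  have hlogcard : Real.log (ballTraces G).card ≤ (2 * k * (2 * k + 2)) * Real.log T := by
    have h := Real.log_le_log (by exact_mod_cast hpos)
      (show ((ballTraces G).card : ℝ) ≤ (T : ℝ) ^ (2 * k * (2 * k + 2)) by exact_mod_cast hcard)
    rw [Real.log_pow] at h
    exact_mod_cast h
  rw [Real.log_mul (by positivity) (by positivity), Real.log_pow]
  have h1 : (k : ℝ) * Real.log 3 ≤ k * Real.log T := by gcongr
  have h2 : 0 ≤ (k : ℝ) * (k - 1) * Real.log T :=
    mul_nonneg (mul_nonneg (by positivity) (by linarith)) hlogT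
  nlinarith

end OnlineLearning

theorem mainTheorem6 :
    ∃ c : ℝ, 0 < c ∧ ∀ k : ℕ, 1 ≤ k → ∀ T : ℕ, 3 ≤ T →
      (OnlineLearning.calibrationGame k T).value ≤
        ((c * (k : ℝ) ^ 2 * (Real.log T / T) ^ (1 / 2 : ℝ) : ℝ) : EReal) := by
  refine ⟨15, by norm_num, fun k hk T hT => ?_⟩
  have hk' : (1 : ℝ) ≤ k := by exact_mod_cast hk
  have hT' : (3 : ℝ) ≤ T := by exact_mod_cast hT
  have hlogT : 1 ≤ Real.log T := by
    rw [Real.le_log_iff_exp_le (by positivity)]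
    linarith [Real.exp_one_lt_d9]
  rw [← Real.sqrt_eq_rpow]
  set s : ℝ := √(Real.log T / T) with hs
  have hs2 : s ^ 2 = Real.log T / T := Real.sq_sqrt (by positivity)
  have hspos : 0 < s := Real.sqrt_pos.2 (by positivity)
  rcases le_or_gt ((k : ℝ) ^ 2 * s) (1 / 2) with hη | hη
  · obtain ⟨G, hcard, hG⟩ := OnlineLearning.exists_forecast_net hk (show 1 ≤ T by omega)
    refine (OnlineLearning.value_le_of_net hk (by omega) (by positivity) (η := k ^ 2 * s)
      (by positivity) hη hG).trans ?_
    rw [EReal.coe_le_coe_iff]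
    have hlog : Real.log (3 ^ k * (OnlineLearning.ballTraces G).card) / (k ^ 2 * s * T) ≤
        10 * k ^ 2 * s := by
      rw [div_le_iff₀ (by positivity)]
      have hk4 : (k : ℝ) ^ 2 ≤ k ^ 4 := pow_le_pow_right₀ hk' (by norm_num)
      calc _ ≤ 10 * (k : ℝ) ^ 2 * Real.log T := OnlineLearning.log_card_experts_le hk hT hcard
        _ ≤ 10 * (k : ℝ) ^ 4 * Real.log T := by gcongr
        _ = 10 * k ^ 4 * (s ^ 2 * T) := by rw [hs2]; field_simp
        _ = _ := by ring
    have hδ : (k : ℝ) / T ≤ k ^ 2 * s := by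
      have h1 : 1 / (T : ℝ) ≤ s := by
        refine Real.le_sqrt_of_sq_le ?_
        rw [div_pow, one_pow, div_le_div_iff₀ (by positivity) (by positivity)]
        nlinarith
      calc (k : ℝ) / T = k * (1 / T) := by ring
        _ ≤ k ^ 2 * s := by gcongr; nlinarith
    linarith
  · refine (OnlineLearning.value_le_two hk).trans ?_
    rw [EReal.coe_le_coe_iff]
    linarith
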